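/- Let $d\in\mathbb N$ and let $F:\mathbb R^d\to\mathbb R$ be a $\mathbb Z^d$-periodic $C^3$ function with $F(0)=0$ whose set of minimum points on $\mathbb R^d$ is exactly $\mathbb Z^d$ and whose Hessian $D^2F(0)$ is positive definite. Put $h(y,x)=\tfrac12|x-y|^2+F(y)$. Let $\psi:\mathbb R^d\to\mathbb R$ be the (unique) continuous $\mathbb Z^d$-periodic function with $\psi(0)=0$ and $\psi(x)=\min_{y\in\mathbb R^d}\{\psi(y)+h(y,x)\}$ for all $x\in\mathbb R^d$, and write $h_\psi(y,x)=\psi(y)+h(y,x)$. Let $\Phi(x,p)=(x+p+\nabla F(x),\,p+\nabla F(x))$ on $\mathbb R^d\times\mathbb R^d$, let $\mathcal G_\psi=\{(x,\nabla\psi(x)) : \psi \text{ is differentiable at } x\}$, and let $\mathcal D^-(\psi)=\pi_1\Phi^{-1}(\overline{\mathcal G_\psi})$, where $\pi_1$ is the projection to the first factor. Proposition. There exist an open set $U\subset\mathbb R^d$ with $U\supset\mathcal D^-(\psi)$ and a constant $\delta>0$, depending only on $F$, such that the following hold. 1. $\psi$ is $C^3$ on $U$ and its second derivatives are uniformly bounded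 on $U$. 2. For every $x\in U$ the function $h_\psi(\cdot,x)$ has a unique minimum point $\bar y(x)$ on $\mathbb R^d$, and $$h_\psi(y,x)-h_\psi(\bar y(x),x)\ \ge\ \delta\,|y-\bar y(x)|^2\qquad\text{for all } x\in U,\ y\in\mathbb R^d .$$ Moreover $$h_\psi(y,x)-\min h_\psi(\cdot,x)\ \ge\ \delta\qquad\text{for all } x\in\mathbb R^d,\ y\in\mathbb R^d\setminus U .$$ -/

import Mathlib

/-! # Kicked Hamilton-Jacobi equation: potential, generating function, stationary solution -/

namespace KickedHJ

/-- `ℝ^d` with its Euclidean norm. -/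
abbrev Space (d : ℕ) : Type := EuclideanSpace ℝ (Fin d)

/-- The vector of `ℝ^d` with integer coordinates `k`. -/
def intVec {d : ℕ} (k : Fin d → ℤ) : Space d := WithLp.toLp 2 fun i => (k i : ℝ)

/-- `ℤ^d`-periodic functions on `ℝ^d`. -/
def IsPeriodic {d : ℕ} (f : Space d → ℝ) : Prop :=
  ∀ (x : Space d) (k : Fin d → ℤ), f (x + intVec k) = f x

/-- Standing assumption on the kick potential: `F` is periodic and `C^3`, its only minimum point
on the torus is `0` (so on `ℝ^d` the minimum points are exactly the integer vectors), `F 0 = 0`,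
and the Hessian of `F` at `0` is positive definite. -/
structure IsKickPotential {d : ℕ} (F : Space d → ℝ) : Prop where
  contDiff : ContDiff ℝ 3 F
  periodic : IsPeriodic F
  argmin : {x | IsMinOn F Set.univ x} = Set.range (intVec (d := d))
  map_zero : F 0 = 0
  hessian_pos : ∀ v : Space d, v ≠ 0 → 0 < iteratedFDeriv ℝ 2 F 0 ![v, v]

/-- The generating function `h(y, x) = |x - y|^2 / 2 + F(y)`. -/
noncomputable def genFun {d : ℕ} (F : Space d → ℝ) (y x : Space d) : ℝ :=
  ‖x - y‖ ^ 2 / 2 + F y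

/-- `h_ψ(y, x) = ψ(y) + h(y, x)`. -/
noncomputable def genFunPsi {d : ℕ} (F ψ : Space d → ℝ) (y x : Space d) : ℝ :=
  ψ y + genFun F y x

/-- `ψ` is a normalized stationary solution: a continuous periodic fixed point of the Lax-Oleinik
operator, `ψ(x) = min_y {ψ(y) + h(y, x)}` for all `x`, with `ψ(0) = 0`. -/
structure IsStationary {d : ℕ} (F ψ : Space d → ℝ) : Prop where
  continuous : Continuous ψ
  periodic : IsPeriodic ψ
  map_zero : ψ 0 = 0
  fixed : ∀ x, IsLeast (Set.range fun y => genFunPsi F ψ y x) (ψ x)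

/-- The set of minimum points of `h_ψ(·, x)` on `ℝ^d`. -/
def argminPsi {d : ℕ} (F ψ : Space d → ℝ) (x : Space d) : Set (Space d) :=
  {y | ∀ z, genFunPsi F ψ y x ≤ genFunPsi F ψ z x}

/-- The twist map `Φ(x, p) = (x + p + ∇F(x), p + ∇F(x))`. -/
noncomputable def twistMap {d : ℕ} (F : Space d → ℝ) (z : Space d × Space d) :
    Space d × Space d :=
  (z.1 + z.2 + gradient F z.1, z.2 + gradient F z.1)

/-- The pseudograph of `ψ`: the graph of `∇ψ` over the points of differentiability of `ψ`. -/
def pseudograph {d : ℕ} (ψ : Space d → ℝ) : Set (Space d × Space d) :=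
  {z | DifferentiableAt ℝ ψ z.1 ∧ z.2 = gradient ψ z.1}

/-- `D^-(ψ)`: the projection to the first factor of the preimage under `Φ` of the closure of the
pseudograph of `ψ`. -/
def domMinus {d : ℕ} (F ψ : Space d → ℝ) : Set (Space d) :=
  Prod.fst '' (twistMap F ⁻¹' closure (pseudograph ψ))

end KickedHJ

/-! Choose for each x a minimizer g(x) of h_ψ(·, x). Where g is continuous, ∇ψ(x) = x − g(x), so ψ
is C^3 wherever g is C^2; the proposition reduces to regularity of g.

Near 0: since F ≥ 0, ψ does not increase along backward orbits, so orbits starting near 0 stay near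
0. They are bounded solutions of the Euler-Lagrange recurrence. Positivity of H = D²F(0) makes the
linear part a contraction on bounded sequences (`‖(2 + H)⁻¹‖ < 1/2`), so the implicit function
theorem makes the whole orbit a C^2 function of its starting point (`IsStationary.contDiffAt_zero`).

Propagation: ψ always has paraboloids above it. If x minimizes h_ψ(·, z) for some z, a paraboloid
also touches ψ from below at x, and the two bounds give quadratic growth of h_ψ(·, x) around g(x)
(`TouchesBelow.quadratic_growth`). If ψ is C^3 near g(x), this growth makes ∇ψ + ∇F + id locally
invertible at g(x), and its inverse is g near x. So C^3 regularity passes from g(x) to x. Backward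
orbits enter every neighbourhood of the lattice, because ψ drops by at least F at each step; hence ψ
is C^3 at every minimizer (`IsStationary.contDiffAt_of_mem`).

Periodicity and compactness then give one bound n for all minimizers and a uniform gap off U, the
interior of the points controlled by n. Every point of D^-(ψ) is a minimizer, so D^-(ψ) ⊆ U.
Uniqueness of ψ makes U and the constants depend on F alone. -/

set_option linter.unusedSectionVars false
open Filter Topology Set
open scoped BoundedContinuousFunction

namespace KickedHJ

/-! ### Superposition operators on bounded sequences -/

section Nemytskii

variable {E F : Type} [NormedAddCommGroup E] [NormedSpace ℝ E] [ProperSpace E]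
  [NormedAddCommGroup F] [NormedSpace ℝ F]

/-- The superposition operator `y ↦ f ∘ y` on bounded sequences. -/
def nemytskii (f : C(E, F)) (y : ℕ →ᵇ E) : ℕ →ᵇ F where
  toFun k := f (y k)
  continuous_toFun := by fun_prop
  map_bounded' := by
    have hb : Bornology.IsBounded (f '' Metric.closedBall 0 ‖y‖) :=
      ((isCompact_closedBall (0 : E) ‖y‖).image f.continuous).isBounded
    obtain ⟨C, hC⟩ := Metric.isBounded_iff.1 hb
    refine ⟨C, fun j k => hC ⟨y j, ?_, rfl⟩ ⟨y k, ?_, rfl⟩⟩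
    · simpa using y.norm_coe_le_norm j
    · simpa using y.norm_coe_le_norm k

@[simp] lemma nemytskii_apply (f : C(E, F)) (y : ℕ →ᵇ E) (k : ℕ) :
    nemytskii f y k = f (y k) := rfl

/-- A continuous map is uniformly continuous around the values of a bounded sequence. -/
lemma exists_delta_of_bounded_seq {G : Type} [NormedAddCommGroup G] (f : C(E, G)) (y : ℕ →ᵇ E)
    {ε : ℝ} (hε : 0 < ε) :
    ∃ δ > 0, ∀ k, ∀ z ∈ Metric.ball (y k) δ, ‖f z - f (y k)‖ ≤ ε := by
  have hu := (isCompact_closedBall (0 : E) (‖y‖ + 1)).uniformContinuousOn_of_continuous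
    f.continuous.continuousOn
  obtain ⟨δ, hδ, h⟩ := Metric.uniformContinuousOn_iff.1 hu ε hε
  refine ⟨min δ 1, by positivity, fun k z hz => ?_⟩
  have hyk := y.norm_coe_le_norm k
  have hz' : ‖z - y k‖ < min δ 1 := by simpa [dist_eq_norm] using hz
  have h1 : ‖z‖ ≤ ‖z - y k‖ + ‖y k‖ := by simpa using norm_add_le (z - y k) (y k)
  have := h z (by simp; linarith [min_le_right δ 1]) (y k) (by simp; linarith)
    (by rw [dist_eq_norm]; exact hz'.trans_le (min_le_left _ _))
  rw [dist_eq_norm] at this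
  exact this.le

lemma continuous_nemytskii (f : C(E, F)) : Continuous (nemytskii f) := by
  refine continuous_iff_continuousAt.2 fun y => Metric.continuousAt_iff.2 fun ε hε => ?_
  obtain ⟨δ, hδ, h⟩ := exists_delta_of_bounded_seq f y (half_pos hε)
  refine ⟨δ, hδ, fun {z} hz => ?_⟩
  refine lt_of_le_of_lt ((BoundedContinuousFunction.dist_le (half_pos hε).le).2 fun k => ?_)
    (half_lt_self hε)
  rw [dist_eq_norm]
  exact h k _ (lt_of_le_of_lt (BoundedContinuousFunction.dist_coe_le_dist k) hz)

/-- Pointwise application of a bounded sequence of operators to a bounded sequence of vectors. -/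
noncomputable def seqApply : (ℕ →ᵇ (E →L[ℝ] F)) →L[ℝ] (ℕ →ᵇ E) →L[ℝ] (ℕ →ᵇ F) :=
  LinearMap.mkContinuous₂
    (LinearMap.mk₂ ℝ
      (fun (A : ℕ →ᵇ (E →L[ℝ] F)) (v : ℕ →ᵇ E) =>
        BoundedContinuousFunction.ofNormedAddCommGroup (fun k => A k (v k))
          continuous_of_discreteTopology (‖A‖ * ‖v‖) (fun k =>
            (A k).le_of_opNorm_le_of_le (A.norm_coe_le_norm k) (v.norm_coe_le_norm k)))
      (fun _ _ _ => by ext; simp) (fun _ _ _ => by ext; simp)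
      (fun _ _ _ => by ext; simp) (fun _ _ _ => by ext; simp)) 1
    (fun A v => (BoundedContinuousFunction.norm_le (by positivity)).2 fun k => by
      rw [one_mul]
      exact (A k).le_of_opNorm_le_of_le (A.norm_coe_le_norm k) (v.norm_coe_le_norm k))

@[simp] lemma seqApply_apply (A : ℕ →ᵇ (E →L[ℝ] F)) (v : ℕ →ᵇ E) (k : ℕ) :
    seqApply A v k = A k (v k) := rfl

/-- The mean value inequality applies in each coordinate with the same radius, because the values of
a bounded sequence lie in a compact ball. -/
lemma hasFDerivAt_nemytskii (f : C(E, F)) (f' : C(E, E →L[ℝ] F))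
    (hf : ∀ x, HasFDerivAt f (f' x) x) (y : ℕ →ᵇ E) :
    HasFDerivAt (nemytskii f) (seqApply (nemytskii f' y)) y := by
  rw [hasFDerivAt_iff_isLittleO, Asymptotics.isLittleO_iff]
  intro c hc
  obtain ⟨δ, hδ, h⟩ := exists_delta_of_bounded_seq f' y hc
  filter_upwards [Metric.ball_mem_nhds y hδ] with z hz
  refine (BoundedContinuousFunction.norm_le (by positivity)).2 fun k => ?_
  have hzk : z k ∈ Metric.ball (y k) δ :=
    lt_of_le_of_lt (BoundedContinuousFunction.dist_coe_le_dist k) hz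
  have := (convex_ball (y k) δ).norm_image_sub_le_of_norm_hasFDerivWithin_le'
    (f := f) (f' := f') (φ := f' (y k)) (fun w _ => (hf w).hasFDerivWithinAt)
    (h k) (Metric.mem_ball_self hδ) hzk
  refine this.trans ?_
  gcongr
  exact (z - y).norm_coe_le_norm k

/-- The derivative is again a superposition operator, that of f', followed by a bounded linear map.
The target space varies in the induction because f' is operator-valued. -/
lemma contDiff_nemytskii (n : ℕ) : ∀ {F : Type} [NormedAddCommGroup F] [NormedSpace ℝ F]
    (f : C(E, F)), ContDiff ℝ n f → ContDiff ℝ n (nemytskii f) := by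
  induction n with
  | zero => intro F _ _ f _; exact contDiff_zero.2 (continuous_nemytskii f)
  | succ n ih =>
    intro F _ _ f hf
    obtain ⟨f', hf', hd⟩ := contDiff_succ_iff_hasFDerivAt.1 hf
    refine contDiff_succ_iff_hasFDerivAt.2
      ⟨fun y => seqApply (nemytskii ⟨f', hf'.continuous⟩ y), ?_,
        hasFDerivAt_nemytskii f ⟨f', hf'.continuous⟩ hd⟩
    exact seqApply.contDiff.comp (ih ⟨f', hf'.continuous⟩ hf')

end Nemytskii

/-! ### Implicit function theorem for bounded orbits -/

section Implicit

/-- Smooth dependence on parameters of the fixed point of a contraction, near the origin. -/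
lemma exists_contDiffAt_fixedPoint {E X : Type} [NormedAddCommGroup E] [NormedSpace ℝ E]
    [CompleteSpace E] [NormedAddCommGroup X] [NormedSpace ℝ X] [CompleteSpace X]
    {n : WithTop ℕ∞} (hn : n ≠ 0) {T : E × X → X} (hT : ContDiffAt ℝ n T 0) (hT0 : T 0 = 0)
    {T' : E × X →L[ℝ] X} (hT' : HasFDerivAt T T' 0)
    (hnorm : ‖T'.comp (ContinuousLinearMap.inr ℝ E X)‖ < 1) :
    ∃ η : E → X, ContDiffAt ℝ n η 0 ∧ ∀ᶠ v in 𝓝 (0 : E × X), T v = v.2 → v.2 = η v.1 := by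
  set D := T'.comp (ContinuousLinearMap.inr ℝ E X) with hD
  -- Fixed points of T(x, ·) are exactly the u with Φ(x, u) = (x, 0), so the inverse function
  -- theorem for Φ yields η.
  let Φ : E × X → E × X := fun v => (v.1, v.2 - T v)
  let Φ' : E × X →L[ℝ] E × X :=
    (ContinuousLinearMap.fst ℝ E X).prod (ContinuousLinearMap.snd ℝ E X - T')
  have hΦ : ContDiffAt ℝ n Φ 0 := contDiffAt_fst.prodMk (contDiffAt_snd.sub hT)
  have hΦ' : HasFDerivAt Φ Φ' 0 := hasFDerivAt_fst.prodMk (hasFDerivAt_snd.sub hT')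
  have hsplit : ∀ v : E × X, T' v = T' (v.1, 0) + D v.2 := fun v => by
    rw [hD, ContinuousLinearMap.comp_apply, ← map_add]; simp
  have hinj : Function.Injective Φ' := by
    refine (injective_iff_map_eq_zero Φ').2 fun v hv => ?_
    have h1 : v.1 = 0 := congrArg Prod.fst hv
    have h2 : v.2 - T' v = 0 := congrArg Prod.snd hv
    rw [hsplit, h1, show ((0 : E), (0 : X)) = 0 from rfl, map_zero, zero_add, sub_eq_zero] at h2
    have h3 : ‖v.2‖ ≤ ‖D‖ * ‖v.2‖ := by
      conv_lhs => rw [h2]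
      exact D.le_opNorm _
    have h4 : ‖v.2‖ = 0 := by nlinarith [norm_nonneg v.2]
    exact Prod.ext h1 (norm_eq_zero.1 h4)
  have hsurj : Function.Surjective Φ' := by
    rintro ⟨a, b⟩
    let u := Units.oneSub D hnorm
    let c := (↑u⁻¹ : X →L[ℝ] X) (b + T' (a, 0))
    have hc : c - D c = b + T' (a, 0) := by
      have : ((u : X →L[ℝ] X) * (↑u⁻¹ : X →L[ℝ] X)) (b + T' (a, 0)) =
          (1 : X →L[ℝ] X) (b + T' (a, 0)) := by rw [Units.mul_inv]
      exact this
    refine ⟨(a, c), Prod.ext rfl ?_⟩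
    change c - T' (a, c) = b
    rw [hsplit]
    change c - (T' (a, 0) + D c) = b
    rw [← sub_sub, sub_right_comm, hc]; simp
  let e := ContinuousLinearEquiv.ofBijective Φ' (LinearMap.ker_eq_bot.2 hinj)
    (LinearMap.range_eq_top.2 hsurj)
  have he : HasFDerivAt Φ (e : E × X →L[ℝ] E × X) 0 := by
    rwa [ContinuousLinearEquiv.coe_ofBijective]
  have hΦ0 : Φ 0 = 0 := by simp [Φ, hT0]
  refine ⟨fun x => (hΦ.localInverse he hn (x, 0)).2, ?_, ?_⟩
  · have h1 := hΦ.to_localInverse he hn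
    rw [hΦ0] at h1
    exact contDiffAt_snd.comp (0 : E)
      (ContDiffAt.comp (0 : E) h1 (contDiffAt_id.prodMk contDiffAt_const))
  · filter_upwards [(hΦ.hasStrictFDerivAt' he hn).eventually_left_inverse] with v hv hTv
    have : Φ v = (v.1, 0) := by simp [Φ, hTv]
    rw [this] at hv
    exact (congrArg Prod.snd hv).symm

lemma exists_contDiffAt_fixedPoint_linear_add {E X : Type} [NormedAddCommGroup E]
    [NormedSpace ℝ E] [CompleteSpace E] [NormedAddCommGroup X] [NormedSpace ℝ X] [CompleteSpace X]
    {n : WithTop ℕ∞} (hn : n ≠ 0) (L : E × X →L[ℝ] X) {N : X → X} (hN : ContDiff ℝ n N)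
    (hN0 : N 0 = 0) (hN' : HasFDerivAt N (0 : X →L[ℝ] X) 0)
    (hnorm : ‖L.comp (ContinuousLinearMap.inr ℝ E X)‖ < 1) :
    ∃ η : E → X, ContDiffAt ℝ n η 0 ∧
      ∀ᶠ v in 𝓝 (0 : E × X), L v + N v.2 = v.2 → v.2 = η v.1 := by
  have hd : HasFDerivAt (fun v : E × X => L v + N v.2) L 0 := by
    have h := L.hasFDerivAt (x := 0) |>.fun_add
      (HasFDerivAt.comp (f := Prod.snd) (g := N) (0 : E × X) hN' hasFDerivAt_snd)
    simpa using h
  exact exists_contDiffAt_fixedPoint hn (L.contDiff.add (hN.comp contDiff_snd)).contDiffAt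
    (by simp [hN0]) hd hnorm

variable {E : Type} [NormedAddCommGroup E] [NormedSpace ℝ E]

/-- Prepending a vector to a bounded sequence. -/
noncomputable def consSeq : E × (ℕ →ᵇ E) →L[ℝ] (ℕ →ᵇ E) :=
  LinearMap.mkContinuous
    { toFun := fun v => BoundedContinuousFunction.ofNormedAddCommGroup
        (fun k => Nat.casesOn k v.1 v.2) continuous_of_discreteTopology ‖v‖ (by
          rintro (_ | k)
          · exact norm_fst_le v
          · exact (v.2.norm_coe_le_norm k).trans (norm_snd_le v))
      map_add' := by intro v w; ext (_ | k) <;> rfl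
      map_smul' := by intro c v; ext (_ | k) <;> rfl } 1
    (fun v => (BoundedContinuousFunction.norm_le (by positivity)).2 (by
      rw [one_mul]
      rintro (_ | k)
      · exact norm_fst_le v
      · exact (v.2.norm_coe_le_norm k).trans (norm_snd_le v)))

@[simp] lemma consSeq_zero (v : E × (ℕ →ᵇ E)) : consSeq v 0 = v.1 := rfl

@[simp] lemma consSeq_succ (v : E × (ℕ →ᵇ E)) (k : ℕ) : consSeq v (k + 1) = v.2 k := rfl

/-- Bounded solutions near `0` of the second order recurrence
`y k = A (y (k + 1) + y (k - 1) + G (y k))` are smooth functions of the initial value. -/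
lemma exists_contDiffAt_of_recurrence [FiniteDimensional ℝ E] (A : E →L[ℝ] E) (hA : ‖A‖ < 1 / 2)
    {n : ℕ} (hn : n ≠ 0) (G : E → E) (hG : ContDiff ℝ n G) (hG0 : G 0 = 0)
    (hG' : fderiv ℝ G 0 = 0) :
    ∃ η : E → (ℕ →ᵇ E), ContDiffAt ℝ n η 0 ∧ ∃ ε > 0, ∀ (x : E) (y : ℕ →ᵇ E), ‖x‖ < ε → ‖y‖ < ε →
      (∀ k, y k = A (y (k + 1) + consSeq (x, y) k + G (y k))) → y = η x := by
  have : ProperSpace E := FiniteDimensional.proper ℝ E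
  have : CompleteSpace E := FiniteDimensional.complete ℝ E
  let Gc : C(E, E) := ⟨G, hG.continuous⟩
  let Gc' : C(E, E →L[ℝ] E) := ⟨fderiv ℝ G, hG.continuous_fderiv (by exact_mod_cast hn)⟩
  let shift : (ℕ →ᵇ E) →L[ℝ] (ℕ →ᵇ E) :=
    BoundedContinuousFunction.compContinuousCLM E ℝ ⟨Nat.succ, continuous_of_discreteTopology⟩
  let A' : (ℕ →ᵇ E) →L[ℝ] (ℕ →ᵇ E) := A.compLeftContinuousBounded ℕ
  let L : E × (ℕ →ᵇ E) →L[ℝ] (ℕ →ᵇ E) :=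
    A'.comp (shift.comp (ContinuousLinearMap.snd ℝ E (ℕ →ᵇ E)) + consSeq)
  have hLk : ∀ v k, L v k = A (v.2 (k + 1) + consSeq v k) := fun _ _ => rfl
  have hN : ContDiff ℝ n (fun y => A' (nemytskii Gc y)) :=
    A'.contDiff.comp (contDiff_nemytskii n Gc hG)
  have hN0 : A' (nemytskii Gc 0) = 0 := by
    ext1 k
    change A (G 0) = 0
    rw [hG0, map_zero]
  have hN' : HasFDerivAt (fun y => A' (nemytskii Gc y)) (0 : (ℕ →ᵇ E) →L[ℝ] (ℕ →ᵇ E)) 0 := by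
    have h := HasFDerivAt.comp (0 : ℕ →ᵇ E) A'.hasFDerivAt (hasFDerivAt_nemytskii Gc Gc'
      (fun x => ((hG.differentiable (by exact_mod_cast hn)) x).hasFDerivAt) 0)
    have h0 : nemytskii Gc' (0 : ℕ →ᵇ E) = 0 := by
      ext1 k
      exact hG'
    rw [h0, map_zero, ContinuousLinearMap.comp_zero] at h
    exact h
  have hnorm : ‖L.comp (ContinuousLinearMap.inr ℝ E (ℕ →ᵇ E))‖ < 1 := by
    -- The two neighbours y (k + 1) and y (k - 1) contribute at most 2‖y‖, which is why `‖A‖ < 1 /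
    -- 2` is the right threshold.
    refine lt_of_le_of_lt (b := ‖A‖ * 2) ?_ (by linarith)
    refine ContinuousLinearMap.opNorm_le_bound _ (by positivity) fun y => ?_
    refine (BoundedContinuousFunction.norm_le (by positivity)).2 fun k => ?_
    rw [ContinuousLinearMap.comp_apply, hLk, mul_assoc]
    refine A.le_opNorm_of_le ?_
    have h2 : ‖consSeq ((0 : E), y) k‖ ≤ ‖y‖ := by
      rcases k with _ | k
      · simp
      · simpa using y.norm_coe_le_norm k
    have h3 := norm_add_le (y (k + 1)) (consSeq ((0 : E), y) k)
    have h4 := y.norm_coe_le_norm (k + 1)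
    change ‖y (k + 1) + consSeq ((0 : E), y) k‖ ≤ 2 * ‖y‖
    linarith
  obtain ⟨η, hη, hev⟩ := exists_contDiffAt_fixedPoint_linear_add (by exact_mod_cast hn) L hN hN0
    hN' hnorm
  obtain ⟨ε, hε, h⟩ := Metric.eventually_nhds_iff.1 hev
  refine ⟨η, hη, ε, hε, fun x y hx hy hrec => h (y := (x, y)) ?_ ?_⟩
  · rw [dist_zero_right]; exact max_lt hx hy
  · ext1 k
    exact ((hrec k).trans (map_add A _ _)).symm

end Implicit

/-! ### Integer translations and periodicity -/

section Lattice

variable {d : ℕ}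

lemma intVec_apply (k : Fin d → ℤ) (i : Fin d) : intVec k i = (k i : ℝ) := rfl

@[simp] lemma intVec_zero : intVec (0 : Fin d → ℤ) = 0 := by
  ext i; simp [intVec_apply]

lemma intVec_neg (k : Fin d → ℤ) : intVec (-k) = -intVec k := by
  ext i; simp [intVec_apply]

lemma one_le_norm_intVec {k : Fin d → ℤ} (hk : k ≠ 0) : 1 ≤ ‖intVec k‖ := by
  obtain ⟨i, hi⟩ := Function.ne_iff.1 hk
  have h1 : ‖intVec k i‖ ≤ ‖intVec k‖ := PiLp.norm_apply_le _ i
  have h2 : (1 : ℝ) ≤ |(k i : ℝ)| := by exact_mod_cast Int.one_le_abs hi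
  rw [intVec_apply, Real.norm_eq_abs] at h1
  exact h2.trans h1

lemma IsPeriodic.sub {f : Space d → ℝ} (hf : IsPeriodic f) (x : Space d) (k : Fin d → ℤ) :
    f (x - intVec k) = f x := by
  rw [sub_eq_add_neg, ← intVec_neg, hf]

lemma IsPeriodic.apply_intVec {f : Space d → ℝ} (hf : IsPeriodic f) (k : Fin d → ℤ) :
    f (intVec k) = f 0 := by
  simpa using hf 0 k

/-- The closed unit cube, which meets every class modulo `ℤ^d`. -/
def unitCube (d : ℕ) : Set (Space d) :=
  WithLp.toLp 2 '' (Set.univ.pi fun _ : Fin d => Icc (0 : ℝ) 1)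

lemma isCompact_unitCube (d : ℕ) : IsCompact (unitCube d) :=
  (isCompact_univ_pi fun _ => isCompact_Icc).image (PiLp.continuous_toLp 2 _)

lemma exists_add_intVec_mem_unitCube (x : Space d) : ∃ k, x + intVec k ∈ unitCube d := by
  refine ⟨fun i => -⌊x i⌋, fun i => Int.fract (x i), ?_, ?_⟩
  · intro i _
    exact ⟨Int.fract_nonneg _, (Int.fract_lt_one _).le⟩
  · ext i
    simp [intVec_apply, Int.fract, sub_eq_add_neg]

/-- Invariance of a subset of `ℝ^d` under integer translations. -/
def IsPeriodicSet (V : Set (Space d)) : Prop :=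
  ∀ (x : Space d) (k : Fin d → ℤ), x ∈ V → x + intVec k ∈ V

lemma IsPeriodicSet.of_add {V : Set (Space d)} (hV : IsPeriodicSet V) {x : Space d}
    {k : Fin d → ℤ} (h : x + intVec k ∈ V) : x ∈ V := by
  have := hV _ (-k) h
  rwa [intVec_neg, add_neg_cancel_right] at this

lemma IsPeriodicSet.interior {V : Set (Space d)} (hV : IsPeriodicSet V) :
    IsPeriodicSet (interior V) := by
  intro x k hx
  rw [mem_interior] at hx ⊢
  obtain ⟨W, hWV, hW, hxW⟩ := hx
  refine ⟨(fun z => z - intVec k) ⁻¹' W, fun z hz => ?_, hW.preimage (by fun_prop), by simpa⟩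
  have := hV _ k (hWV hz)
  simpa using this

lemma IsPeriodic.exists_abs_le {f : Space d → ℝ} (hf : IsPeriodic f) (hc : Continuous f) :
    ∃ C, ∀ x, |f x| ≤ C := by
  obtain ⟨C, hC⟩ := (isCompact_unitCube d).exists_bound_of_continuousOn hc.continuousOn
  refine ⟨C, fun x => ?_⟩
  obtain ⟨k, hk⟩ := exists_add_intVec_mem_unitCube x
  rw [← hf x k]
  exact hC _ hk

end Lattice

/-! ### First-order conditions in a Hilbert space -/

section Gradients

variable {E : Type} [NormedAddCommGroup E] [InnerProductSpace ℝ E] [CompleteSpace E]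

open InnerProductSpace

lemma hasGradientAt_half_norm_sub_sq (a z : E) :
    HasGradientAt (fun z => ‖z - a‖ ^ 2 / 2) (z - a) z := by
  rw [hasGradientAt_iff_hasFDerivAt]
  have h := ((hasFDerivAt_id (𝕜 := ℝ) z).sub_const a).norm_sq.mul_const (2 : ℝ)⁻¹
  simp only [div_eq_mul_inv]
  refine h.congr_fderiv ?_
  ext v
  simp

lemma hasGradientAt_add {f g : E → ℝ} {p q z : E} (hf : HasGradientAt f p z)
    (hg : HasGradientAt g q z) : HasGradientAt (fun z => f z + g z) (p + q) z := by
  rw [hasGradientAt_iff_hasFDerivAt] at *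
  rw [map_add]
  exact HasFDerivAt.fun_add hf hg

lemma eq_zero_of_hasGradientAt_of_isMinOn {f : E → ℝ} {p z : E} (hf : HasGradientAt f p z)
    (h : ∀ w, f z ≤ f w) : p = 0 := by
  rw [hasGradientAt_iff_hasFDerivAt] at hf
  have : toDual ℝ E p = 0 :=
    IsLocalMin.hasFDerivAt_eq_zero (Eventually.of_forall h) hf
  simpa using this

/-- If `q` is dominated by a quadratic function near `0`, then `q = 0`. -/
lemma eq_zero_of_inner_le_sq {q : E} {c : ℝ} (h : ∀ w : E, inner ℝ q w ≤ c * ‖w‖ ^ 2) :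
    q = 0 := by
  have hc : 0 < |c| + 1 := by positivity
  have h1 := h ((|c| + 1)⁻¹ • q)
  rw [inner_smul_right, real_inner_self_eq_norm_sq, norm_smul, mul_pow, Real.norm_eq_abs,
    sq_abs] at h1
  by_contra hq
  have h2 : 0 < ‖q‖ ^ 2 := by positivity
  have h3 : (|c| + 1)⁻¹ ≤ c * (|c| + 1)⁻¹ ^ 2 := by
    refine le_of_mul_le_mul_right ?_ h2
    linarith
  have h4 : c * (|c| + 1)⁻¹ ^ 2 < (|c| + 1)⁻¹ := by
    rw [inv_pow, ← div_eq_mul_inv, div_lt_iff₀ (by positivity), sq, inv_mul_cancel_left₀ hc.ne']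
    linarith [le_abs_self c]
  linarith

lemma norm_sub_sq_half_expand (x y z : E) :
    ‖z - y‖ ^ 2 / 2 = ‖x - y‖ ^ 2 / 2 + inner ℝ (x - y) (z - x) + ‖z - x‖ ^ 2 / 2 := by
  have h := norm_add_sq_real (x - y) (z - x)
  rw [show x - y + (z - x) = z - y by abel] at h
  linarith

end Gradients

/-! ### Stationary solutions, backward orbits and uniqueness -/

section Stationary

variable {d : ℕ} {F ψ : Space d → ℝ}

lemma IsKickPotential.nonneg (hF : IsKickPotential F) (x : Space d) : 0 ≤ F x := by
  have : (0 : Space d) ∈ {x | IsMinOn F Set.univ x} := by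
    rw [hF.argmin]
    exact ⟨0, intVec_zero⟩
  have h := isMinOn_iff.1 this x (mem_univ _)
  rwa [hF.map_zero] at h

lemma IsKickPotential.eq_intVec (hF : IsKickPotential F) {x : Space d} (h : F x ≤ 0) :
    ∃ k, x = intVec k := by
  have : x ∈ {x | IsMinOn F Set.univ x} :=
    isMinOn_iff.2 fun y _ => h.trans (hF.nonneg y)
  rw [hF.argmin] at this
  obtain ⟨k, hk⟩ := this
  exact ⟨k, hk.symm⟩

lemma IsKickPotential.hasGradientAt (hF : IsKickPotential F) (x : Space d) :
    HasGradientAt F (gradient F x) x :=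
  ((hF.contDiff.differentiable (by norm_num)) x).hasGradientAt

lemma IsKickPotential.contDiff_gradient (hF : IsKickPotential F) : ContDiff ℝ 2 (gradient F) :=
  (InnerProductSpace.toDual ℝ (Space d)).symm.contDiff.comp
    (hF.contDiff.fderiv_right (m := 2) (by norm_num))

lemma genFunPsi_eq (F ψ : Space d → ℝ) (y x : Space d) :
    genFunPsi F ψ y x = ψ y + (‖x - y‖ ^ 2 / 2 + F y) := rfl

lemma genFunPsi_add (hF : IsPeriodic F) (hψ : IsPeriodic ψ) (y x : Space d) (k : Fin d → ℤ) :
    genFunPsi F ψ (y + intVec k) (x + intVec k) = genFunPsi F ψ y x := by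
  simp only [genFunPsi_eq, hF y k, hψ y k, add_sub_add_right_eq_sub]

lemma IsStationary.le (hψ : IsStationary F ψ) (x y : Space d) : ψ x ≤ genFunPsi F ψ y x :=
  (hψ.fixed x).2 ⟨y, rfl⟩

lemma IsStationary.exists_backMap (hψ : IsStationary F ψ) :
    ∃ g : Space d → Space d, ∀ x, genFunPsi F ψ (g x) x = ψ x := by
  choose g hg using fun x => (hψ.fixed x).1
  exact ⟨g, hg⟩

lemma IsStationary.mem_argminPsi (hψ : IsStationary F ψ) {x y : Space d} :
    y ∈ argminPsi F ψ x ↔ genFunPsi F ψ y x = ψ x := by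
  constructor
  · intro h
    obtain ⟨z, hz⟩ := (hψ.fixed x).1
    exact le_antisymm ((h z).trans hz.le) (hψ.le x y)
  · intro h z
    rw [h]
    exact hψ.le x z

lemma continuous_genFunPsi (hF : IsKickPotential F) (hψ : IsStationary F ψ) :
    Continuous fun p : Space d × Space d => genFunPsi F ψ p.2 p.1 := by
  have h1 := hF.contDiff.continuous
  have h2 := hψ.continuous
  simp only [genFunPsi_eq]
  fun_prop

/-- The stationary solution attains its minimum `0` exactly on `ℤ^d`. -/
lemma IsStationary.nonneg_and_eq_intVec (hF : IsKickPotential F) (hψ : IsStationary F ψ) :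
    (∀ x, 0 ≤ ψ x) ∧ ∀ x, ψ x ≤ 0 → ∃ k, x = intVec k := by
  have key : ∀ x, (∀ z, ψ x ≤ ψ z) → ∃ k, x = intVec k := by
    intro x hx
    obtain ⟨y, hy⟩ := (hψ.fixed x).1
    have hy' : ψ y + (‖x - y‖ ^ 2 / 2 + F y) = ψ x := hy
    have h1 := hx y
    have h2 := hF.nonneg y
    have h3 : ‖x - y‖ ^ 2 = 0 := by nlinarith [sq_nonneg ‖x - y‖]
    have h4 : x = y := by simpa [sub_eq_zero] using h3
    subst h4
    exact hF.eq_intVec (by linarith [sq_nonneg ‖x - x‖])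
  obtain ⟨k0, hk0⟩ := exists_add_intVec_mem_unitCube (0 : Space d)
  obtain ⟨m, -, hm⟩ := (isCompact_unitCube d).exists_isMinOn ⟨_, hk0⟩ hψ.continuous.continuousOn
  have hm' : ∀ z, ψ m ≤ ψ z := fun z => by
    obtain ⟨k, hk⟩ := exists_add_intVec_mem_unitCube z
    rw [← hψ.periodic z k]
    exact isMinOn_iff.1 hm _ hk
  obtain ⟨k, rfl⟩ := key m hm'
  rw [hψ.periodic.apply_intVec, hψ.map_zero] at hm'
  exact ⟨hm', fun x hx => key x fun z => hx.trans (hm' z)⟩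

lemma IsStationary.nonneg (hF : IsKickPotential F) (hψ : IsStationary F ψ) (x : Space d) :
    0 ≤ ψ x := (hψ.nonneg_and_eq_intVec hF).1 x

lemma IsKickPotential.exists_sublevel_subset (hF : IsKickPotential F) {V : Set (Space d)}
    (hV : IsOpen V) (hVp : IsPeriodicSet V) (h0 : (0 : Space d) ∈ V) :
    ∃ ε > 0, ∀ y, F y < ε → y ∈ V := by
  obtain ⟨ε, hε, h⟩ := ((isCompact_unitCube d).diff hV).exists_forall_le' (a := 0)
    hF.contDiff.continuous.continuousOn (fun y hy => by
      by_contra hy0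
      obtain ⟨k, rfl⟩ := hF.eq_intVec (not_lt.1 hy0)
      refine hy.2 ?_
      simpa using hVp 0 k h0)
  refine ⟨ε, hε, fun y hy => ?_⟩
  obtain ⟨k, hk⟩ := exists_add_intVec_mem_unitCube y
  refine hVp.of_add (k := k) ?_
  by_contra hn
  have := h _ ⟨hk, hn⟩
  rw [hF.periodic] at this
  linarith

/-- Backward minimizing orbits enter every periodic neighbourhood of `ℤ^d`. -/
lemma IsStationary.exists_iterate_mem (hF : IsKickPotential F) (hψ : IsStationary F ψ)
    {g : Space d → Space d} (hg : ∀ x, genFunPsi F ψ (g x) x = ψ x) {V : Set (Space d)}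
    (hV : IsOpen V) (hVp : IsPeriodicSet V) (h0 : (0 : Space d) ∈ V) (x : Space d) :
    ∃ n, g^[n] x ∈ V := by
  obtain ⟨ε, hε, h⟩ := hF.exists_sublevel_subset hV hVp h0
  by_contra hn
  push Not at hn
  -- Each step outside V costs at least ε, which nonnegativity of ψ allows only finitely often.
  have hstep : ∀ n : ℕ, ψ (g^[n] x) + n * ε ≤ ψ x := by
    intro n
    induction n with
    | zero => simp
    | succ n ih =>
      have h1 := hg (g^[n] x)
      rw [← Function.iterate_succ_apply' g n x, genFunPsi_eq] at h1
      have h2 : ε ≤ F (g^[n + 1] x) := not_lt.1 fun hlt => hn _ (h _ hlt)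
      push_cast
      nlinarith [sq_nonneg ‖g^[n] x - g^[n + 1] x‖]
  obtain ⟨n, hn'⟩ := exists_nat_gt (ψ x / ε)
  rw [div_lt_iff₀ hε] at hn'
  linarith [hstep n, hψ.nonneg hF (g^[n] x)]

lemma IsStationary.iterate_le (hψ' : IsStationary F ψ) {φ : Space d → ℝ}
    {g : Space d → Space d} (hg : ∀ x, genFunPsi F φ (g x) x = φ x) (x : Space d) (n : ℕ) :
    ψ x - φ x ≤ ψ (g^[n] x) - φ (g^[n] x) := by
  induction n with
  | zero => simp
  | succ n ih =>
    refine ih.trans ?_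
    rw [Function.iterate_succ_apply']
    have h1 := hψ'.le (g^[n] x) (g (g^[n] x))
    have h2 := hg (g^[n] x)
    rw [genFunPsi_eq] at h1 h2
    linarith

/-- Along a minimizing orbit of φ the difference ψ − φ never decreases, and the orbit reaches points
where ψ < ε while φ ≥ 0. -/
lemma IsStationary.le_of_isStationary (hF : IsKickPotential F) {φ : Space d → ℝ}
    (hφ : IsStationary F φ) (hψ : IsStationary F ψ) (x : Space d) : ψ x ≤ φ x := by
  obtain ⟨g, hg⟩ := hφ.exists_backMap
  refine le_of_forall_pos_le_add fun ε hε => ?_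
  obtain ⟨n, hn⟩ := hφ.exists_iterate_mem hF hg (V := ψ ⁻¹' Iio ε)
    (isOpen_Iio.preimage hψ.continuous)
    (fun x k hx => by simpa [hψ.periodic x k] using hx) (by simpa [hψ.map_zero] using hε) x
  have h1 := hψ.iterate_le hg x n
  have h2 := hφ.nonneg hF (g^[n] x)
  have h3 : ψ (g^[n] x) < ε := hn
  linarith

lemma IsStationary.unique (hF : IsKickPotential F) {φ : Space d → ℝ} (hφ : IsStationary F φ)
    (hψ : IsStationary F ψ) : ψ = φ :=
  funext fun x => le_antisymm (hφ.le_of_isStationary hF hψ x) (hψ.le_of_isStationary hF hφ x)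

/-- The discrete Euler-Lagrange equation along minimizing orbits. -/
lemma IsStationary.euler_lagrange (hF : IsKickPotential F) (hψ : IsStationary F ψ)
    {x y z : Space d} (hy : genFunPsi F ψ y x = ψ x) (hz : genFunPsi F ψ x z = ψ z) :
    x - y + (x - z) + gradient F x = 0 := by
  -- The middle point x minimizes the two-step action from y to z.
  refine eq_zero_of_hasGradientAt_of_isMinOn
    (f := fun w => ‖w - y‖ ^ 2 / 2 + ‖w - z‖ ^ 2 / 2 + F w) (z := x)
    (hasGradientAt_add (hasGradientAt_add (hasGradientAt_half_norm_sub_sq y x)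
      (hasGradientAt_half_norm_sub_sq z x)) (hF.hasGradientAt x)) fun w => ?_
  have h1 := hψ.le w y
  have h2 := hψ.le z w
  rw [genFunPsi_eq] at h1 h2 hy hz
  simp only [norm_sub_rev _ z]
  linarith

/-- First-order condition for h_ψ(·, x) at y. It makes the backward map a right inverse of ∇ψ + ∇F +
id where ψ is differentiable. -/
lemma IsStationary.gradient_of_mem (hF : IsKickPotential F) (hψ : IsStationary F ψ)
    {x y p : Space d} (hy : genFunPsi F ψ y x = ψ x) (hp : HasGradientAt ψ p y) :
    p + gradient F y + y = x := by
  have := eq_zero_of_hasGradientAt_of_isMinOn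
    (f := fun w => ψ w + F w + ‖w - x‖ ^ 2 / 2) (z := y)
    (hasGradientAt_add (hasGradientAt_add hp (hF.hasGradientAt y))
      (hasGradientAt_half_norm_sub_sq x y)) fun w => by
      have h1 := hψ.le x w
      rw [genFunPsi_eq] at h1 hy
      simp only [norm_sub_rev _ x]
      linarith
  rw [← add_sub_assoc, sub_eq_zero] at this
  exact this

/-- Semiconcavity: each minimum point of `h_ψ(·, x)` gives a supergradient of `ψ` at `x`. -/
lemma IsStationary.le_add_inner (hψ : IsStationary F ψ) {x y : Space d}
    (hy : genFunPsi F ψ y x = ψ x) (z : Space d) :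
    ψ z ≤ ψ x + inner ℝ (x - y) (z - x) + ‖z - x‖ ^ 2 / 2 := by
  have h1 := hψ.le z y
  have h2 := norm_sub_sq_half_expand x y z
  rw [genFunPsi_eq] at h1 hy
  linarith

lemma IsStationary.gradient_eq_sub (hψ : IsStationary F ψ) {x y p : Space d}
    (hy : genFunPsi F ψ y x = ψ x) (hp : HasGradientAt ψ p x) : p = x - y := by
  have hneg : HasGradientAt (fun z => -ψ z) (-p) x := by
    rw [hasGradientAt_iff_hasFDerivAt] at *
    rw [map_neg]
    exact hp.fun_neg
  have := eq_zero_of_hasGradientAt_of_isMinOn (f := fun w => -ψ w + ‖w - y‖ ^ 2 / 2) (z := x)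
    (hasGradientAt_add hneg (hasGradientAt_half_norm_sub_sq y x)) fun w => by
      have h1 := hψ.le w y
      rw [genFunPsi_eq] at h1 hy
      linarith
  rw [neg_add_eq_zero] at this
  exact this

/-- Where the backward minimizer is a continuous function, it determines the gradient of `ψ`. -/
lemma IsStationary.hasGradientAt (hψ : IsStationary F ψ) {g : Space d → Space d}
    (hg : ∀ x, genFunPsi F ψ (g x) x = ψ x) {x : Space d} (hc : ContinuousAt g x) :
    HasGradientAt ψ (x - g x) x := by
  rw [hasGradientAt_iff_isLittleO, Asymptotics.isLittleO_iff]
  intro c hc0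
  have hev : ∀ᶠ z in 𝓝 x, ‖(z - g z) - (x - g x)‖ < c / 2 := by
    have : ContinuousAt (fun z => (z - g z) - (x - g x)) x := by fun_prop
    have h0 := this.norm
    simp only [ContinuousAt, sub_self, norm_zero] at h0
    exact h0.eventually_lt_const (by positivity)
  filter_upwards [hev, Metric.ball_mem_nhds x hc0] with z hz hzx
  rw [Metric.mem_ball, dist_eq_norm] at hzx
  have h1 := hψ.le_add_inner (hg x) z
  have h2 := hψ.le_add_inner (hg z) x
  have h3 : inner ℝ (z - g z) (x - z) = - inner ℝ ((z - g z) - (x - g x)) (z - x)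
      - inner ℝ (x - g x) (z - x) := by
    rw [← neg_sub z x, inner_neg_right, inner_sub_left (z - g z)]
    ring
  have h4 := abs_real_inner_le_norm ((z - g z) - (x - g x)) (z - x)
  rw [norm_sub_rev x z] at h2
  have h5 := abs_le.1 h4
  have h6 : ‖(z - g z) - (x - g x)‖ * ‖z - x‖ ≤ c / 2 * ‖z - x‖ := by gcongr
  have h7 : ‖z - x‖ ^ 2 ≤ c * ‖z - x‖ := by rw [sq]; gcongr
  rw [Real.norm_eq_abs, abs_le]
  constructor <;> linarith

/-- One derivative is gained: ∇ψ = id − g wherever g is continuous. -/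
lemma IsStationary.contDiffAt_of_eventuallyEq (hψ : IsStationary F ψ) {g : Space d → Space d}
    (hg : ∀ x, genFunPsi F ψ (g x) x = ψ x) {x : Space d} {η : Space d → Space d}
    (hη : ContDiffAt ℝ 2 η x) (h : g =ᶠ[𝓝 x] η) : ContDiffAt ℝ 3 ψ x := by
  rw [show (3 : WithTop ℕ∞) = (2 : ℕ) + 1 by norm_num]
  rw [contDiffAt_succ_iff_hasFDerivAt]
  have hg2 : ContDiffAt ℝ 2 g x := hη.congr_of_eventuallyEq h
  refine ⟨fun z => InnerProductSpace.toDual ℝ (Space d) (z - g z),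
    ⟨_, hg2.eventually (by norm_num), fun z hz => ?_⟩, ?_⟩
  · have hz' : ContDiffAt ℝ 2 g z := hz
    exact (hψ.hasGradientAt hg hz'.continuousAt).hasFDerivAt
  · exact (InnerProductSpace.toDual ℝ (Space d)).contDiff.contDiffAt.comp x (contDiffAt_id.sub hg2)

end Stationary

/-! ### Coercivity, Taylor bounds and quadratic growth -/

section Calculus

variable {E : Type} [NormedAddCommGroup E] [InnerProductSpace ℝ E]

lemma exists_coercive_const [FiniteDimensional ℝ E] (H : E →L[ℝ] E)
    (hH : ∀ v, v ≠ 0 → 0 < inner ℝ (H v) v) : ∃ l > 0, ∀ v, l * ‖v‖ ^ 2 ≤ inner ℝ (H v) v := by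
  have : ProperSpace E := FiniteDimensional.proper ℝ E
  obtain ⟨l, hl, h⟩ := (isCompact_sphere (0 : E) 1).exists_forall_le' (a := 0)
    (f := fun v => inner ℝ (H v) v) (by fun_prop)
    (fun v hv => hH v (by rintro rfl; simp at hv))
  refine ⟨l, hl, fun v => ?_⟩
  rcases eq_or_ne v 0 with rfl | hv
  · simp
  have hv' : ‖v‖ ≠ 0 := norm_ne_zero_iff.2 hv
  have h1 := h (‖v‖⁻¹ • v) (by simp [norm_smul, hv'])
  rw [map_smul, inner_smul_left, inner_smul_right] at h1
  simp only [conj_trivial] at h1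
  have h2 : 0 < ‖v‖ := norm_pos_iff.2 hv
  calc l * ‖v‖ ^ 2 ≤ (‖v‖⁻¹ * (‖v‖⁻¹ * inner ℝ (H v) v)) * ‖v‖ ^ 2 := by gcongr
    _ = inner ℝ (H v) v := by field_simp

/-- If `H` is positive definite, then `2 + H` has an inverse of norm less than `1 / 2`. -/
lemma exists_inverse_two_add [FiniteDimensional ℝ E] (H : E →L[ℝ] E)
    (hH : ∀ v, v ≠ 0 → 0 < inner ℝ (H v) v) :
    ∃ A : E →L[ℝ] E, ‖A‖ < 1 / 2 ∧ ∀ v, A ((2 : ℝ) • v + H v) = v := by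
  obtain ⟨l, hl, h⟩ := exists_coercive_const H hH
  let B : E →L[ℝ] E := (2 : ℝ) • ContinuousLinearMap.id ℝ E + H
  have hB : ∀ v, B v = (2 : ℝ) • v + H v := fun _ => rfl
  have hlow : ∀ v, (2 + l) * ‖v‖ ≤ ‖B v‖ := fun v => by
    rcases (norm_nonneg v).eq_or_lt with hv | hv
    · rw [← hv]; simp
    have h1 := real_inner_le_norm (B v) v
    rw [hB, inner_add_left, inner_smul_left, real_inner_self_eq_norm_sq, ← hB] at h1
    simp only [conj_trivial] at h1
    refine le_of_mul_le_mul_right ?_ hv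
    nlinarith [h v]
  have hinj : Function.Injective (B : E →ₗ[ℝ] E) := by
    refine (injective_iff_map_eq_zero _).2 fun v hv => ?_
    have h1 := hlow v
    rw [show B v = 0 from hv, norm_zero] at h1
    have : ‖v‖ = 0 := by nlinarith [norm_nonneg v]
    exact norm_eq_zero.1 this
  let e := LinearEquiv.ofInjectiveEndo (B : E →ₗ[ℝ] E) hinj
  have he : ∀ v, e v = B v := fun v => rfl
  refine ⟨LinearMap.toContinuousLinearMap (e.symm : E →ₗ[ℝ] E), ?_, fun v => ?_⟩
  · refine lt_of_le_of_lt (b := (2 + l)⁻¹) ?_ ?_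
    · refine ContinuousLinearMap.opNorm_le_bound _ (by positivity) fun w => ?_
      have h1 := hlow (e.symm w)
      rw [← he, e.apply_symm_apply] at h1
      rw [inv_mul_eq_div, le_div_iff₀ (by positivity), mul_comm]
      exact h1
    · rw [one_div]
      exact inv_strictAnti₀ (by norm_num) (by linarith)
  · change e.symm _ = v
    rw [← hB, ← he, e.symm_apply_apply]

/-- A global second order Taylor estimate, locally uniform in the base point. -/
lemma exists_taylor_bound {f : E → ℝ} {b : ℝ} (hb : ∀ x, |f x| ≤ b) {x₀ : E}
    (hf : ContDiffAt ℝ 2 f x₀) :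
    ∃ C ≥ 0, ∀ᶠ x in 𝓝 x₀, ∀ z, |f z - f x - fderiv ℝ f x (z - x)| ≤ C * ‖z - x‖ ^ 2 := by
  have hb0 : 0 ≤ b := (abs_nonneg _).trans (hb x₀)
  obtain ⟨K, s, hs, hK⟩ :=
    (hf.fderiv_right (m := 1) (by norm_num)).exists_lipschitzOnWith
  have hdiff : ∀ᶠ x in 𝓝 x₀, DifferentiableAt ℝ f x := by
    filter_upwards [hf.eventually (by norm_num)] with x hx
    exact hx.differentiableAt (by norm_num)
  obtain ⟨ρ, hρ, hball⟩ := Metric.mem_nhds_iff.1 (inter_mem hs hdiff)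
  let R := ρ / 2
  have hR : 0 < R := half_pos hρ
  let M := ‖fderiv ℝ f x₀‖ + K * R
  have hM0 : 0 ≤ M := by positivity
  -- K, the Lipschitz constant of the derivative, serves for ‖z − x‖ < R; the other terms serve for
  -- distant z, where boundedness of f suffices.
  refine ⟨K + (2 * b / R ^ 2 + M / R), by positivity, ?_⟩
  filter_upwards [Metric.ball_mem_nhds x₀ hR] with x hx z
  have hx' : x ∈ Metric.ball x₀ ρ := Metric.ball_subset_ball (by simp [R]; linarith) hx
  rcases lt_or_ge ‖z - x‖ R with hz | hz
  · have hsub : Metric.closedBall x ‖z - x‖ ⊆ Metric.ball x₀ ρ := by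
      intro w hw
      have h1 := dist_triangle w x x₀
      rw [Metric.mem_closedBall] at hw
      rw [Metric.mem_ball] at hx ⊢
      have : R + R = ρ := add_halves ρ
      linarith
    have h1 := (convex_closedBall x ‖z - x‖).norm_image_sub_le_of_norm_hasFDerivWithin_le'
      (f := f) (f' := fderiv ℝ f) (φ := fderiv ℝ f x) (x := x) (y := z) (C := K * ‖z - x‖)
      (fun w hw => ((hball (hsub hw)).2 : DifferentiableAt ℝ f w).hasFDerivAt.hasFDerivWithinAt)
      (fun w hw => by
        have h2 := hK.norm_sub_le (hball (hsub hw)).1 (hball hx').1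
        rw [Metric.mem_closedBall, dist_eq_norm] at hw
        exact h2.trans (by gcongr))
      (Metric.mem_closedBall_self (norm_nonneg _)) (by simp [dist_eq_norm])
    rw [Real.norm_eq_abs] at h1
    refine h1.trans ?_
    rw [mul_assoc, ← sq]
    gcongr
    have : 0 ≤ 2 * b / R ^ 2 + M / R := by positivity
    linarith
  · have hMx : ‖fderiv ℝ f x‖ ≤ M := by
      have h2 := hK.norm_sub_le (hball hx').1 (hball (Metric.mem_ball_self hρ)).1
      have h3 : ‖x - x₀‖ ≤ R := by
        rw [← dist_eq_norm]; exact (Metric.mem_ball.1 hx).le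
      have h4 := norm_add_le (fderiv ℝ f x - fderiv ℝ f x₀) (fderiv ℝ f x₀)
      rw [sub_add_cancel] at h4
      have h5 : K * ‖x - x₀‖ ≤ K * R := by gcongr
      simp only [M]
      linarith
    have h1 : |fderiv ℝ f x (z - x)| ≤ M * ‖z - x‖ :=
      (fderiv ℝ f x).le_of_opNorm_le hMx _
    have h2 : 2 * b ≤ 2 * b / R ^ 2 * ‖z - x‖ ^ 2 := by
      rw [div_mul_eq_mul_div, le_div_iff₀ (by positivity)]
      gcongr
    have h3 : M * ‖z - x‖ ≤ M / R * ‖z - x‖ ^ 2 := by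
      rw [div_mul_eq_mul_div, le_div_iff₀ (by positivity), sq, mul_assoc]
      gcongr
    have h4 : 0 ≤ K * ‖z - x‖ ^ 2 := by positivity
    have h5 := abs_le.1 (hb z)
    have h6 := abs_le.1 (hb x)
    have h7 := abs_le.1 h1
    rw [abs_le]
    constructor <;> linarith

/-- At a point of quadratic growth, the derivative of the gradient is injective. -/
lemma eq_zero_of_quadratic_growth [CompleteSpace E] {k : E → ℝ} {V : E → E} {V' : E →L[ℝ] E}
    {y₀ v : E} {δ : ℝ} (hδ : 0 < δ) (hk : ∀ᶠ z in 𝓝 y₀, HasGradientAt k (V z) z) (hV0 : V y₀ = 0)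
    (hV' : HasFDerivAt V V' y₀) (hgrow : ∀ z, δ * ‖z - y₀‖ ^ 2 ≤ k z - k y₀) (hv : V' v = 0) :
    v = 0 := by
  by_contra hv0
  have hline : Tendsto (fun t : ℝ => y₀ + t • v) (𝓝 0) (𝓝 y₀) := by
    have : Continuous fun t : ℝ => y₀ + t • v := by fun_prop
    simpa using this.tendsto 0
  -- If V' v = 0, the gradient is o(t) along y₀ + t v, so by the mean value theorem k grows too
  -- slowly on this line.
  have hlit := (hasFDerivAt_iff_isLittleO.1 hV').bound (half_pos hδ)
  obtain ⟨r, hr, h⟩ := Metric.eventually_nhds_iff.1 (hline.eventually (hlit.and hk))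
  have hpos : 0 < r / 2 := half_pos hr
  have habs : ∀ s ∈ Icc 0 (r / 2), dist s 0 < r := fun s hs => by
    rw [Real.dist_eq, sub_zero, abs_of_nonneg hs.1]
    linarith [hs.2]
  have hder : ∀ s ∈ Icc 0 (r / 2),
      HasDerivAt (fun s : ℝ => k (y₀ + s • v)) (inner ℝ (V (y₀ + s • v)) v) s := fun s hs => by
    have h1 := (h (habs s hs)).2.hasFDerivAt
    have h2 : HasDerivAt (fun s : ℝ => y₀ + s • v) v s := by
      simpa using ((hasDerivAt_id s).smul_const v).const_add y₀
    have h3 := h1.comp_hasDerivAt s h2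
    rw [InnerProductSpace.toDual_apply_apply] at h3
    exact h3
  obtain ⟨ξ, hξ, heq⟩ := exists_hasDerivAt_eq_slope (fun s : ℝ => k (y₀ + s • v))
    (fun s => inner ℝ (V (y₀ + s • v)) v) hpos
    (fun s hs => (hder s hs).continuousAt.continuousWithinAt)
    (fun s hs => hder s (Ioo_subset_Icc_self hs))
  have h1 := hgrow (y₀ + (r / 2) • v)
  have h2 := (h (habs ξ (Ioo_subset_Icc_self hξ))).1
  simp only [add_sub_cancel_left, hV0, sub_zero, map_smul, hv, smul_zero, norm_smul,
    Real.norm_eq_abs, abs_of_pos hξ.1] at h2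
  simp only [add_sub_cancel_left, norm_smul, Real.norm_eq_abs, abs_of_pos hpos] at h1
  rw [sub_zero, zero_smul, add_zero, eq_div_iff hpos.ne'] at heq
  rw [← heq] at h1
  have h3 := real_inner_le_norm (V (y₀ + ξ • v)) v
  have hvn : 0 < ‖v‖ := norm_pos_iff.2 hv0
  have h4 : inner ℝ (V (y₀ + ξ • v)) v ≤ δ / 2 * (r / 2) * ‖v‖ ^ 2 := by
    refine h3.trans ?_
    calc ‖V (y₀ + ξ • v)‖ * ‖v‖ ≤ δ / 2 * (ξ * ‖v‖) * ‖v‖ := by gcongr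
      _ ≤ δ / 2 * ((r / 2) * ‖v‖) * ‖v‖ := by gcongr; exact hξ.2.le
      _ = _ := by ring
  have h5 : inner ℝ (V (y₀ + ξ • v)) v * (r / 2) ≤ δ / 2 * (r / 2) * ‖v‖ ^ 2 * (r / 2) := by
    gcongr
  have h6 : 0 < δ * (r / 2) ^ 2 * ‖v‖ ^ 2 := by positivity
  nlinarith

end Calculus

/-! ### Regularity of ψ near the origin -/

section NearZero

variable {d : ℕ} {F ψ : Space d → ℝ}

lemma IsKickPotential.gradient_zero (hF : IsKickPotential F) : gradient F 0 = 0 :=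
  eq_zero_of_hasGradientAt_of_isMinOn (hF.hasGradientAt 0) fun w => by
    rw [hF.map_zero]; exact hF.nonneg w

lemma IsKickPotential.inner_fderiv_gradient_pos (hF : IsKickPotential F) {v : Space d}
    (hv : v ≠ 0) : 0 < inner ℝ (fderiv ℝ (gradient F) 0 v) v := by
  have h := hF.hessian_pos v hv
  rw [iteratedFDeriv_two_apply] at h
  have hd : HasFDerivAt (gradient F) (fderiv ℝ (gradient F) 0) 0 :=
    ((hF.contDiff_gradient.differentiable (by norm_num)) 0).hasFDerivAt
  have hdd : HasFDerivAt (fderiv ℝ F) (fderiv ℝ (fderiv ℝ F) 0) 0 :=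
    (((hF.contDiff.fderiv_right (m := 2) (by norm_num)).differentiable (by norm_num)) 0).hasFDerivAt
  have h1 : HasFDerivAt (fun x => fderiv ℝ F x v) _ 0 :=
    hdd.clm_apply (hasFDerivAt_const v (0 : Space d))
  have h2 : HasFDerivAt (fun x => inner ℝ (gradient F x) v) _ 0 :=
    hd.inner ℝ (hasFDerivAt_const v (0 : Space d))
  simp only [inner_gradient_left] at h2
  have h3 := congrArg (fun L : Space d →L[ℝ] ℝ => L v) (h1.unique h2)
  simp at h3
  simpa [h3] using h

/-- Backward minimizing orbits that start close to `0` stay close to `0`. -/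
lemma IsStationary.eventually_iterate_norm_lt (hF : IsKickPotential F) (hψ : IsStationary F ψ)
    {g : Space d → Space d} (hg : ∀ x, genFunPsi F ψ (g x) x = ψ x) {r : ℝ} (hr : 0 < r)
    (hr1 : 2 * r < 1) : ∀ᶠ x in 𝓝 (0 : Space d), ∀ n, ‖g^[n] x‖ < r := by
  -- On the annulus r ≤ ‖y‖ ≤ 2r, which contains no lattice point, ψ ≥ c > 0. Once ψ < min c (r²/2),
  -- steps are shorter than r and cannot jump over the annulus, nor land in it.
  have hcomp : IsCompact (Metric.closedBall (0 : Space d) (2 * r) \ Metric.ball 0 r) :=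
    (isCompact_closedBall _ _).diff Metric.isOpen_ball
  obtain ⟨c, hc, h⟩ := hcomp.exists_forall_le' (a := 0) hψ.continuous.continuousOn
    (fun y hy => by
      by_contra hy0
      obtain ⟨k, rfl⟩ := (hψ.nonneg_and_eq_intVec hF).2 y (not_lt.1 hy0)
      have h1 : ‖intVec k‖ ≤ 2 * r := by simpa using hy.1
      have h2 : r ≤ ‖intVec k‖ := by simpa using hy.2
      rcases eq_or_ne k 0 with rfl | hk
      · simp at h2; linarith
      · linarith [one_le_norm_intVec hk])
  have hev : ∀ᶠ x in 𝓝 (0 : Space d), ψ x < min c (r ^ 2 / 2) := by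
    have := hψ.continuous.tendsto 0
    rw [hψ.map_zero] at this
    exact this.eventually_lt_const (by positivity)
  filter_upwards [hev, Metric.ball_mem_nhds 0 hr] with x hx hxr n
  have key : ∀ n, ‖g^[n] x‖ < r ∧ ψ (g^[n] x) < min c (r ^ 2 / 2) := by
    intro n
    induction n with
    | zero => exact ⟨by simpa using hxr, hx⟩
    | succ n ih =>
      rw [Function.iterate_succ_apply']
      set z := g^[n] x
      have h1 := hg z
      rw [genFunPsi_eq] at h1
      have h2 := hF.nonneg (g z)
      have h3 := hψ.nonneg hF (g z)
      have h4 : ψ (g z) < min c (r ^ 2 / 2) := by nlinarith [sq_nonneg ‖z - g z‖]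
      refine ⟨?_, h4⟩
      have h5 : ‖z - g z‖ < r := by
        refine lt_of_pow_lt_pow_left₀ 2 hr.le ?_
        linarith [ih.2, min_le_right c (r ^ 2 / 2)]
      have h6 : ‖g z‖ ≤ 2 * r := by
        have := norm_sub_le z (z - g z)
        rw [sub_sub_cancel] at this
        linarith [ih.1]
      by_contra hn
      have := h (g z) ⟨by simpa using h6, by simpa using hn⟩
      linarith [min_le_left c (r ^ 2 / 2)]
  exact (key n).1

/-- The stationary solution is `C^3` near `0`. -/
lemma IsStationary.contDiffAt_zero (hF : IsKickPotential F) (hψ : IsStationary F ψ) :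
    ContDiffAt ℝ 3 ψ 0 := by
  obtain ⟨g, hg⟩ := hψ.exists_backMap
  set H := fderiv ℝ (gradient F) 0 with hH
  have hd : HasFDerivAt (gradient F) H 0 :=
    ((hF.contDiff_gradient.differentiable (by norm_num)) 0).hasFDerivAt
  obtain ⟨A, hA, hAB⟩ := exists_inverse_two_add H fun v hv => hF.inner_fderiv_gradient_pos hv
  have hG' : HasFDerivAt (fun y => H y - gradient F y) (H - H) 0 := H.hasFDerivAt.fun_sub hd
  obtain ⟨η, hη, ε, hε, huniq⟩ := exists_contDiffAt_of_recurrence A hA (n := 2) (by norm_num)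
    (fun y => H y - gradient F y) (H.contDiff.sub hF.contDiff_gradient)
    (by simp [hF.gradient_zero]) (by rw [hG'.fderiv, sub_self])
  set r := min (ε / 2) (1 / 3) with hr
  have hr0 : 0 < r := by positivity
  have hrε : r < ε := (min_le_left _ _).trans_lt (half_lt_self hε)
  have hr1 : 2 * r < 1 := by linarith [min_le_right (ε / 2) (1 / 3)]
  have heval : ContDiff ℝ 2 (fun u : ℕ →ᵇ Space d => u 0) :=
    (BoundedContinuousFunction.evalCLM ℝ 0 : (ℕ →ᵇ Space d) →L[ℝ] Space d).contDiff
  refine hψ.contDiffAt_of_eventuallyEq hg (η := fun x => η x 0)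
    (ContDiffAt.comp (g := fun u : ℕ →ᵇ Space d => u 0) 0 heval.contDiffAt hη) ?_
  filter_upwards [hψ.eventually_iterate_norm_lt hF hg hr0 hr1] with x hx
  let y : ℕ →ᵇ Space d := BoundedContinuousFunction.ofNormedAddCommGroup (fun k => g^[k + 1] x)
    continuous_of_discreteTopology r (fun k => (hx (k + 1)).le)
  have hyn : ‖y‖ ≤ r := (BoundedContinuousFunction.norm_le hr0.le).2 fun k => (hx (k + 1)).le
  have hy := huniq x y ((hx 0).trans hrε) (hyn.trans_lt hrε) fun k => by
    have hcons : consSeq (x, y) k = g^[k] x := by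
      rcases k with _ | k <;> rfl
    have hEL := hψ.euler_lagrange hF (hg (g^[k + 1] x))
      (z := g^[k] x) (by rw [Function.iterate_succ_apply']; exact hg _)
    rw [← Function.iterate_succ_apply' g (k + 1) x] at hEL
    rw [hcons]
    -- Adding H y to both sides of the Euler-Lagrange equation gives (2 + H) y k = y (k + 1) + y (k
    -- - 1) + (H − ∇F)(y k); then A inverts 2 + H.
    conv_lhs => rw [← hAB (y k)]
    congr 1
    change (2 : ℝ) • g^[k + 1] x + H (g^[k + 1] x)
      = g^[k + 1 + 1] x + g^[k] x + (H (g^[k + 1] x) - gradient F (g^[k + 1] x))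
    rw [two_smul, ← sub_eq_zero, ← hEL]
    abel
  exact congrArg (fun u : ℕ →ᵇ Space d => u 0) hy

end NearZero

/-! ### Touching paraboloids and propagation of regularity -/

section Growth

variable {d : ℕ} {F ψ : Space d → ℝ}

/-- A paraboloid of opening `C` touches `ψ` from below at `x`. -/
def TouchesBelow (ψ : Space d → ℝ) (C : ℝ) (x : Space d) : Prop :=
  ∃ p : Space d, ∀ z, ψ x + inner ℝ p (z - x) - C * ‖z - x‖ ^ 2 ≤ ψ z

lemma TouchesBelow.mono {C C' : ℝ} {x : Space d} (h : TouchesBelow ψ C x) (hC : C ≤ C') :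
    TouchesBelow ψ C' x := by
  obtain ⟨p, hp⟩ := h
  refine ⟨p, fun z => le_trans ?_ (hp z)⟩
  gcongr

/-- The paraboloids above and below must share the slope x − y. Then compare the lower one with ψ ≤
h_ψ(y', ·) at x + a(y' − y). -/
lemma TouchesBelow.quadratic_growth (hψ : IsStationary F ψ) {C : ℝ} (hC : 0 ≤ C) {x y : Space d}
    (h : TouchesBelow ψ C x) (hy : genFunPsi F ψ y x = ψ x) (y' : Space d) :
    (2 * (2 * C + 1))⁻¹ * ‖y' - y‖ ^ 2 ≤ genFunPsi F ψ y' x - ψ x := by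
  obtain ⟨p, hp⟩ := h
  have hpe : p = x - y := by
    rw [← sub_eq_zero]
    refine eq_zero_of_inner_le_sq (c := C + 1 / 2) fun w => ?_
    have h1 := hψ.le_add_inner hy (x + w)
    have h2 := hp (x + w)
    rw [add_sub_cancel_left] at h1 h2
    rw [inner_sub_left]
    linarith
  subst hpe
  -- This a maximizes a − (C + 1/2)a², the growth coefficient obtained.
  set a := (2 * C + 1)⁻¹ with ha
  have ha0 : 0 < a := by positivity
  have hCa : (2 * C + 1) * a = 1 := mul_inv_cancel₀ (by positivity)
  have h1 := hp (x + a • (y' - y))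
  have h2 := hψ.le (x + a • (y' - y)) y'
  have h3 := norm_sub_sq_half_expand x y' (x + a • (y' - y))
  rw [add_sub_cancel_left, inner_smul_right, norm_smul, mul_pow, Real.norm_eq_abs, sq_abs] at h1 h3
  rw [genFunPsi_eq] at h2 ⊢
  have h4 : inner ℝ (x - y) (y' - y) - inner ℝ (x - y') (y' - y) = ‖y' - y‖ ^ 2 := by
    rw [← inner_sub_left, sub_sub_sub_cancel_left, real_inner_self_eq_norm_sq]
  have h5 : (2 * (2 * C + 1))⁻¹ = a - (C + 1 / 2) * a ^ 2 := by
    rw [mul_inv, ← ha]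
    have : (C + 1 / 2) * a ^ 2 = 1 / 2 * a * ((2 * C + 1) * a) := by ring
    rw [this, hCa]
    ring
  rw [h5]
  have h6 : a * inner ℝ (x - y) (y' - y) - a * inner ℝ (x - y') (y' - y) = a * ‖y' - y‖ ^ 2 := by
    rw [← mul_sub, h4]
  linarith

/-- The inequality ψ(w) ≥ ψ(z) − h(w, z) is an equality at w = x, and its right side is C^2 in w. -/
lemma IsStationary.exists_touchesBelow_of_mem (hF : IsKickPotential F) (hψ : IsStationary F ψ)
    {x z : Space d} (hz : genFunPsi F ψ x z = ψ z) : ∃ C ≥ 0, TouchesBelow ψ C x := by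
  obtain ⟨b, hb⟩ := hF.periodic.exists_abs_le hF.contDiff.continuous
  obtain ⟨C, hC, hev⟩ := exists_taylor_bound hb
    (hF.contDiff.contDiffAt.of_le (by norm_num) : ContDiffAt ℝ 2 F x)
  refine ⟨C + 1 / 2, by positivity, -(x - z) - gradient F x, fun w => ?_⟩
  have h1 := (abs_le.1 (hev.self_of_nhds w)).2
  have h2 := hψ.le z w
  have h3 := norm_sub_sq_half_expand x z w
  rw [genFunPsi_eq, norm_sub_rev] at h2 hz
  rw [← inner_gradient_left] at h1
  rw [inner_sub_left, inner_neg_left]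
  linarith

lemma IsStationary.exists_eventually_touchesBelow (hψ : IsStationary F ψ) {x₀ : Space d}
    (h : ContDiffAt ℝ 3 ψ x₀) : ∃ C, ∀ᶠ x in 𝓝 x₀, TouchesBelow ψ C x := by
  obtain ⟨b, hb⟩ := hψ.periodic.exists_abs_le hψ.continuous
  obtain ⟨C, -, hev⟩ := exists_taylor_bound hb (h.of_le (by norm_num) : ContDiffAt ℝ 2 ψ x₀)
  refine ⟨C, hev.mono fun x hx => ⟨gradient ψ x, fun z => ?_⟩⟩
  have h1 := (abs_le.1 (hx z)).1
  rw [inner_gradient_left]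
  linarith

/-- Regularity of `ψ` propagates forward along minimizing orbits which can be continued. -/
lemma IsStationary.contDiffAt_of_backMap (hF : IsKickPotential F) (hψ : IsStationary F ψ)
    {g : Space d → Space d} (hg : ∀ x, genFunPsi F ψ (g x) x = ψ x) {x₀ z₀ : Space d}
    (hz : genFunPsi F ψ x₀ z₀ = ψ z₀) (hC3 : ContDiffAt ℝ 3 ψ (g x₀)) : ContDiffAt ℝ 3 ψ x₀ := by
  obtain ⟨C, hC, htouch⟩ := hψ.exists_touchesBelow_of_mem hF hz
  have hgrow := htouch.quadratic_growth hψ hC (hg x₀)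
  set δ := (2 * (2 * C + 1))⁻¹
  have hδ : 0 < δ := by positivity
  set y₀ := g x₀ with hy₀
  -- Adding the growth at x₀ to the minimality of g x at x leaves only the cross term ⟨x − x₀, g x −
  -- y₀⟩.
  have hlip : ∀ x, ‖g x - y₀‖ ≤ δ⁻¹ * ‖x - x₀‖ := fun x => by
    have h1 := hgrow (g x)
    have h2 := hψ.le x y₀
    have h3 := hg x
    have h4 := hg x₀
    rw [← hy₀] at h4
    have h5 : inner ℝ (x - x₀) (g x - y₀) =
        ‖x₀ - g x‖ ^ 2 / 2 - ‖x - g x‖ ^ 2 / 2 + ‖x - y₀‖ ^ 2 / 2 - ‖x₀ - y₀‖ ^ 2 / 2 := by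
      rw [norm_sub_sq_half_expand x (g x) x₀, norm_sub_sq_half_expand x y₀ x₀,
        ← neg_sub x x₀, inner_neg_right, inner_neg_right, real_inner_comm,
        show g x - y₀ = (x - y₀) - (x - g x) by abel, inner_sub_left]
      ring
    have h6 := real_inner_le_norm (x - x₀) (g x - y₀)
    rw [genFunPsi_eq] at h1 h2 h3 h4
    rcases (norm_nonneg (g x - y₀)).eq_or_lt with h0 | h0
    · rw [← h0]; positivity
    rw [inv_mul_eq_div, le_div_iff₀ hδ]
    refine le_of_mul_le_mul_right ?_ h0
    nlinarith
  have hgt : Tendsto g (𝓝 x₀) (𝓝 y₀) := by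
    rw [tendsto_iff_norm_sub_tendsto_zero]
    refine squeeze_zero (fun _ => norm_nonneg _) hlip ?_
    have : Continuous fun x => δ⁻¹ * ‖x - x₀‖ := by fun_prop
    simpa using this.tendsto x₀
  let V : Space d → Space d := fun z => gradient ψ z + gradient F z + z
  have hgψ : ContDiffAt ℝ 2 (gradient ψ) y₀ :=
    (InnerProductSpace.toDual ℝ (Space d)).symm.contDiff.contDiffAt.comp y₀
      (hC3.fderiv_right (m := 2) (by norm_num))
  have hV : ContDiffAt ℝ 2 V y₀ :=
    (hgψ.add hF.contDiff_gradient.contDiffAt).add contDiffAt_id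
  have hdiff : ∀ᶠ z in 𝓝 y₀, HasGradientAt ψ (gradient ψ z) z := by
    filter_upwards [hC3.eventually (by norm_num)] with z hz
    have hz' : ContDiffAt ℝ 3 ψ z := hz
    exact (hz'.differentiableAt (by norm_num)).hasGradientAt
  have hVy₀ : V y₀ = x₀ := hψ.gradient_of_mem hF (hg x₀) hdiff.self_of_nhds
  have hVd : HasFDerivAt V (fderiv ℝ V y₀) y₀ :=
    (hV.differentiableAt (by norm_num)).hasFDerivAt
  have hinj : Function.Injective (fderiv ℝ V y₀ : Space d →ₗ[ℝ] Space d) := by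
    refine (injective_iff_map_eq_zero _).2 fun v hv => ?_
    refine eq_zero_of_quadratic_growth (k := fun y => ψ y + F y + ‖y - x₀‖ ^ 2 / 2)
      (V := fun z => V z - x₀) hδ ?_ (by rw [hVy₀, sub_self]) (hVd.sub_const x₀) (fun z => ?_) hv
    · filter_upwards [hdiff] with z hz
      have := hasGradientAt_add (hasGradientAt_add hz (hF.hasGradientAt z))
        (hasGradientAt_half_norm_sub_sq x₀ z)
      rwa [← add_sub_assoc] at this
    · have h1 := hgrow z
      have h2 := hg x₀
      rw [genFunPsi_eq, norm_sub_rev x₀] at h1 h2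
      rw [← hy₀] at h2
      linarith
  let e := (LinearEquiv.ofInjectiveEndo (fderiv ℝ V y₀ : Space d →ₗ[ℝ] Space d)
    hinj).toContinuousLinearEquiv
  have he : HasFDerivAt V (e : Space d →L[ℝ] Space d) y₀ := by
    have : (e : Space d →L[ℝ] Space d) = fderiv ℝ V y₀ := by ext1 v; rfl
    rwa [this]
  have hη := hV.to_localInverse he (by norm_num)
  rw [hVy₀] at hη
  refine hψ.contDiffAt_of_eventuallyEq hg hη ?_
  -- Since g x is close to y₀ and V (g x) = x, g agrees with the local inverse of V.
  filter_upwards [hgt.eventually (hV.hasStrictFDerivAt' he (by norm_num)).eventually_left_inverse,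
    hgt.eventually hdiff] with x h1 h2
  have h3 : V (g x) = x := hψ.gradient_of_mem hF (hg x) h2
  rw [h3] at h1
  exact h1.symm

end Growth

/-! ### Uniform control on the set of minimizers -/

section RegularSet

variable {d : ℕ} {F ψ : Space d → ℝ}

lemma IsPeriodic.contDiffAt_add (hψ : IsPeriodic ψ) {n : WithTop ℕ∞} {x : Space d}
    (h : ContDiffAt ℝ n ψ x) (k : Fin d → ℤ) : ContDiffAt ℝ n ψ (x + intVec k) := by
  have h1 : ContDiffAt ℝ n (fun z : Space d => z - intVec k) (x + intVec k) :=
    contDiffAt_id.sub contDiffAt_const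
  have h2 := ContDiffAt.comp (g := ψ) (x + intVec k) (by rwa [add_sub_cancel_right]) h1
  rwa [show ψ ∘ (fun z : Space d => z - intVec k) = ψ from funext fun z => hψ.sub z k] at h2

/-- `ψ` is `C^3` at every point which minimizes `h_ψ(·, z)` for some `z`. -/
lemma IsStationary.contDiffAt_of_mem (hF : IsKickPotential F) (hψ : IsStationary F ψ)
    {x z : Space d} (hz : genFunPsi F ψ x z = ψ z) : ContDiffAt ℝ 3 ψ x := by
  obtain ⟨g, hg⟩ := hψ.exists_backMap
  -- The hypothesis renews itself along the orbit: g x minimizes h_ψ(·, x).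
  have key : ∀ n x z, genFunPsi F ψ x z = ψ z → ContDiffAt ℝ 3 ψ (g^[n] x) →
      ContDiffAt ℝ 3 ψ x := by
    intro n
    induction n with
    | zero => exact fun x z _ h => h
    | succ n ih =>
      intro x z hz h
      rw [Function.iterate_succ_apply] at h
      exact hψ.contDiffAt_of_backMap hF hg hz (ih (g x) x (hg x) h)
  have hper : IsPeriodicSet {x | ContDiffAt ℝ 3 ψ x} :=
    fun x k (hx : ContDiffAt ℝ 3 ψ x) => hψ.periodic.contDiffAt_add hx k
  obtain ⟨n, hn⟩ := hψ.exists_iterate_mem hF hg isOpen_interior hper.interior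
    (mem_interior_iff_mem_nhds.2 ((hψ.contDiffAt_zero hF).eventually (by norm_num))) x
  exact key n x z hz (interior_subset hn)

/-- Points where `ψ` is `C^3`, with quantitative control on its second order behaviour. -/
def regularSet (ψ : Space d → ℝ) (n : ℕ) : Set (Space d) :=
  {x | ContDiffAt ℝ 3 ψ x ∧ ‖iteratedFDeriv ℝ 2 ψ x‖ ≤ n ∧ TouchesBelow ψ n x}

lemma isPeriodicSet_regularSet (hψ : IsPeriodic ψ) (n : ℕ) : IsPeriodicSet (regularSet ψ n) := by
  rintro x k ⟨h1, h2, p, hp⟩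
  refine ⟨hψ.contDiffAt_add h1 k, ?_, p, fun z => ?_⟩
  · rw [← iteratedFDeriv_comp_add_right]
    simpa only [hψ _ k] using h2
  · have := hp (z - intVec k)
    rwa [hψ.sub, sub_right_comm, sub_sub, ← hψ x k] at this

lemma monotone_interior_regularSet (ψ : Space d → ℝ) :
    Monotone fun n => interior (regularSet ψ n) := by
  intro m n hmn
  have hmn' : (m : ℝ) ≤ n := by exact_mod_cast hmn
  exact interior_mono fun x hx => ⟨hx.1, hx.2.1.trans hmn', hx.2.2.mono hmn'⟩

lemma IsStationary.exists_mem_interior_regularSet (hψ : IsStationary F ψ) {x : Space d}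
    (h : ContDiffAt ℝ 3 ψ x) : ∃ n, x ∈ interior (regularSet ψ n) := by
  obtain ⟨C, hC⟩ := hψ.exists_eventually_touchesBelow h
  have hcont : ContinuousAt (fun z => ‖iteratedFDeriv ℝ 2 ψ z‖) x :=
    (h.iteratedFDeriv_right (m := 1) (by norm_num)).continuousAt.norm
  obtain ⟨n, hn⟩ := exists_nat_gt (max C ‖iteratedFDeriv ℝ 2 ψ x‖)
  refine ⟨n, mem_interior_iff_mem_nhds.2 ?_⟩
  filter_upwards [hC, h.eventually (by norm_num),
    hcont.eventually_lt_const ((le_max_right _ _).trans_lt hn)] with z h1 h2 h3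
  exact ⟨h2, h3.le, h1.mono ((le_max_left _ _).trans hn.le)⟩

/-- The slack 1 lets the same compact set serve for the minimizers and for the gap. Since ψ, F ≥ 0,
‖x − y‖²/2 ≤ b + 1, whence ‖x − y‖ ≤ b + 3/2. -/
lemma IsStationary.isCompact_almost_minimizing (hF : IsKickPotential F) (hψ : IsStationary F ψ) :
    IsCompact {q : Space d × Space d | q.1 ∈ unitCube d ∧ genFunPsi F ψ q.2 q.1 ≤ ψ q.1 + 1} := by
  obtain ⟨b, hb⟩ := hψ.periodic.exists_abs_le hψ.continuous
  obtain ⟨r, hr⟩ := (isCompact_unitCube d).isBounded.exists_norm_le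
  refine ((isCompact_unitCube d).prod
    (isCompact_closedBall (0 : Space d) (r + (b + 3 / 2)))).of_isClosed_subset ?_ ?_
  · exact ((isCompact_unitCube d).isClosed.preimage continuous_fst).inter
      (isClosed_le (continuous_genFunPsi hF hψ)
        ((hψ.continuous.comp continuous_fst).add continuous_const))
  · rintro ⟨x, y⟩ ⟨hx, hy⟩
    refine ⟨hx, mem_closedBall_zero_iff.2 ?_⟩
    simp only [genFunPsi_eq] at hy hx
    have h1 := hr x hx
    have h2 := norm_sub_le x (x - y)
    rw [sub_sub_cancel] at h2
    have h3 := (abs_le.1 (hb x)).2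
    have h4 := hψ.nonneg hF y
    have h5 := hF.nonneg y
    change ‖y‖ ≤ _
    nlinarith [sq_nonneg (‖x - y‖ - 1)]

/-- The minimizers lie in the interior of a single regular set. -/
lemma IsStationary.exists_minimizers_subset (hF : IsKickPotential F) (hψ : IsStationary F ψ) :
    ∃ n, ∀ x z, genFunPsi F ψ x z = ψ z → x ∈ interior (regularSet ψ n) := by
  have hcomp : IsCompact (Prod.snd '' {q : Space d × Space d |
      q.1 ∈ unitCube d ∧ genFunPsi F ψ q.2 q.1 = ψ q.1}) := by
    refine ((hψ.isCompact_almost_minimizing hF).of_isClosed_subset ?_ ?_).image continuous_snd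
    · exact ((isCompact_unitCube d).isClosed.preimage continuous_fst).inter
        (isClosed_eq (continuous_genFunPsi hF hψ) (hψ.continuous.comp continuous_fst))
    · rintro q ⟨h1, h2⟩
      exact ⟨h1, by linarith⟩
  obtain ⟨n, hn⟩ := hcomp.elim_directed_cover (fun n => interior (regularSet ψ n))
    (fun _ => isOpen_interior) (by
      rintro _ ⟨q, ⟨-, hq⟩, rfl⟩
      exact mem_iUnion.2 (hψ.exists_mem_interior_regularSet (hψ.contDiffAt_of_mem hF hq)))
    (monotone_interior_regularSet ψ).directed_le
  refine ⟨n, fun x z hz => ?_⟩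
  obtain ⟨k, hk⟩ := exists_add_intVec_mem_unitCube z
  refine (isPeriodicSet_regularSet hψ.periodic n).interior.of_add (k := k)
    (hn ⟨(_, _), ⟨hk, ?_⟩, rfl⟩)
  simp only [genFunPsi_add hF.periodic hψ.periodic, hz, hψ.periodic z k]

/-- Away from a periodic neighbourhood of the minimizers, `h_ψ` exceeds its minimum uniformly. -/
lemma IsStationary.exists_gap (hF : IsKickPotential F) (hψ : IsStationary F ψ)
    {U : Set (Space d)} (hU : IsOpen U) (hUp : IsPeriodicSet U)
    (hmin : ∀ x z, genFunPsi F ψ x z = ψ z → x ∈ U) :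
    ∃ δ > 0, ∀ x, ∀ y ∉ U, δ ≤ genFunPsi F ψ y x - ψ x := by
  have hcont : Continuous fun q : Space d × Space d => genFunPsi F ψ q.2 q.1 - ψ q.1 :=
    (continuous_genFunPsi hF hψ).sub (hψ.continuous.comp continuous_fst)
  obtain ⟨δ, hδ, h⟩ := ((hψ.isCompact_almost_minimizing hF).diff
    (hU.preimage continuous_snd)).exists_forall_le' (a := 0) hcont.continuousOn
    (fun q hq => by
      have h1 := hψ.le q.1 q.2
      rcases h1.eq_or_lt with h2 | h2
      · exact absurd (hmin _ _ h2.symm) hq.2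
      · linarith)
  refine ⟨min δ 1, by positivity, fun x y hy => ?_⟩
  obtain ⟨k, hk⟩ := exists_add_intVec_mem_unitCube x
  rw [← genFunPsi_add hF.periodic hψ.periodic y x k, ← hψ.periodic x k]
  by_cases hle : genFunPsi F ψ (y + intVec k) (x + intVec k) ≤ ψ (x + intVec k) + 1
  · exact (min_le_left _ _).trans
      (h (x + intVec k, y + intVec k) ⟨⟨hk, hle⟩, fun hyU => hy (hUp.of_add hyU)⟩)
  · linarith [min_le_right δ 1]

/-- On the pseudograph p = a − g(a), so a − p minimizes h_ψ(·, a), a closed condition on (a, p). For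
(a, p) = Φ(q), a − p is the first component of q. -/
lemma IsStationary.exists_eq_of_mem_domMinus (hF : IsKickPotential F) (hψ : IsStationary F ψ)
    {x : Space d} (hx : x ∈ domMinus F ψ) : ∃ z, genFunPsi F ψ x z = ψ z := by
  have hclosed : IsClosed {q : Space d × Space d | genFunPsi F ψ (q.1 - q.2) q.1 = ψ q.1} :=
    isClosed_eq ((continuous_genFunPsi hF hψ).comp
      (continuous_fst.prodMk (continuous_fst.sub continuous_snd)))
      (hψ.continuous.comp continuous_fst)
  have hsub : closure (pseudograph ψ) ⊆
      {q : Space d × Space d | genFunPsi F ψ (q.1 - q.2) q.1 = ψ q.1} := by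
    refine closure_minimal ?_ hclosed
    rintro ⟨a, b⟩ ⟨hd, hb⟩
    obtain ⟨g, hg⟩ := hψ.exists_backMap
    have h1 : b = a - g a := hb.trans (hψ.gradient_eq_sub (hg a) hd.hasGradientAt)
    subst h1
    simpa using hg a
  obtain ⟨q, hq, rfl⟩ := hx
  have h1 := hsub hq
  refine ⟨(twistMap F q).1, ?_⟩
  simpa [twistMap, add_assoc] using h1

end RegularSet

end KickedHJ

/-! ### The proposition -/

theorem mainTheorem9 (d : ℕ) (F : KickedHJ.Space d → ℝ) (hF : KickedHJ.IsKickPotential F) :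
    ∃ (U : Set (KickedHJ.Space d)) (δ K : ℝ), IsOpen U ∧ 0 < δ ∧
      ∀ ψ : KickedHJ.Space d → ℝ, KickedHJ.IsStationary F ψ →
        KickedHJ.domMinus F ψ ⊆ U ∧
        (ContDiffOn ℝ 3 ψ U ∧ ∀ x ∈ U, ‖iteratedFDeriv ℝ 2 ψ x‖ ≤ K) ∧
        (∀ x ∈ U, ∃ ybar : KickedHJ.Space d, KickedHJ.argminPsi F ψ x = {ybar} ∧
          ∀ y : KickedHJ.Space d,
            δ * ‖y - ybar‖ ^ 2 ≤ KickedHJ.genFunPsi F ψ y x - KickedHJ.genFunPsi F ψ ybar x) ∧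
        (∀ x : KickedHJ.Space d, ∃ m : ℝ,
          IsLeast (Set.range fun z => KickedHJ.genFunPsi F ψ z x) m ∧
          ∀ y ∉ U, δ ≤ KickedHJ.genFunPsi F ψ y x - m) := by
  -- Without a stationary solution the claim is vacuous; otherwise U is built from one solution and
  -- transferred by uniqueness.
  by_cases hex : ∃ ψ, KickedHJ.IsStationary F ψ
  swap
  · exact ⟨∅, 1, 0, isOpen_empty, one_pos, fun ψ hψ => absurd ⟨ψ, hψ⟩ hex⟩
  obtain ⟨φ, hφ⟩ := hex
  obtain ⟨n, hn⟩ := hφ.exists_minimizers_subset hF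
  obtain ⟨δ, hδ, hgap⟩ := hφ.exists_gap hF isOpen_interior
    (KickedHJ.isPeriodicSet_regularSet hφ.periodic n).interior hn
  refine ⟨interior (KickedHJ.regularSet φ n), min δ (2 * (2 * (n : ℝ) + 1))⁻¹, n, isOpen_interior,
    by positivity, fun ψ hψ => ?_⟩
  obtain rfl := hφ.unique hF hψ
  refine ⟨fun x hx => ?_, ⟨fun x hx => ?_, fun x hx => (interior_subset hx).2.1⟩,
    fun x hx => ?_, fun x => ⟨ψ x, hψ.fixed x, fun y hy => ?_⟩⟩
  · obtain ⟨z, hz⟩ := hψ.exists_eq_of_mem_domMinus hF hx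
    exact hn x z hz
  · exact (interior_subset hx).1.contDiffWithinAt
  · obtain ⟨g, hg⟩ := hψ.exists_backMap
    have hgrow := (interior_subset hx).2.2.quadratic_growth hψ n.cast_nonneg (hg x)
    refine ⟨g x, ?_, fun y => ?_⟩
    · ext y
      rw [hψ.mem_argminPsi, Set.mem_singleton_iff]
      refine ⟨fun hy => ?_, fun hy => hy ▸ hg x⟩
      have h1 := hgrow y
      rw [hy, sub_self] at h1
      have h2 : ‖y - g x‖ ^ 2 ≤ 0 :=
        nonpos_of_mul_nonpos_right h1 (by positivity)
      have h3 : ‖y - g x‖ = 0 := by simpa using le_antisymm h2 (sq_nonneg _)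
      exact sub_eq_zero.1 (norm_eq_zero.1 h3)
    · rw [hg x]
      refine le_trans ?_ (hgrow y)
      gcongr
      exact min_le_right _ _
  · exact (min_le_left _ _).trans (hgap x y hy)
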